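/- Let $\mathfrak g$ be a finite dimensional real semisimple Lie algebra, $\rho:\mathfrak g\to\mathfrak{gl}(V)$ a representation on a finite dimensional real vector space $V$, and $\rho^{\mathbb C}$ the induced representation of $\mathfrak g^{\mathbb C}=\mathfrak g\otimes_{\mathbb R}\mathbb C$ on $V^{\mathbb C}=V\otimes_{\mathbb R}\mathbb C$. Write $\sigma$, or a bar, for the complex conjugations of $\mathfrak g^{\mathbb C}$ and of $V^{\mathbb C}$, and let $G_\rho^{\mathbb C}\subset \mathrm{GL}(V^{\mathbb C})$ be the subgroup generated by all $\exp(z\,\rho(X))$, $z\in\mathbb C$, $X\in\mathfrak g$. For $w\in V^{\mathbb C}$ let $\langle G_\rho^{\mathbb C}w\rangle$ denote the complex linear span of the orbit $G_\rho^{\mathbb C}w$. Let $\mathfrak c$ be a Cartan subalgebra of $\mathfrak g$ (a maximal abelian subalgebra acting diagonalizably on $\mathfrak g^{\mathbb C}$), $R$ the set of roots of $\mathfrak c^{\mathbb C}$ in $\mathfrak g^{\mathbb C}$, $R^+$ a positive system of roots, and $\mathfrak y=\sum_{\alpha\in R^+}(\mathfrak g^{\mathbb C})_\alpha$. A high weight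 vector is a nonzero $v\in V^{\mathbb C}$ that is annihilated by $\mathfrak y$ and is a common eigenvector of $\mathfrak c^{\mathbb C}$. For each simple root $\alpha$ fix $X_{\alpha}\in(\mathfrak g^{\mathbb C})_{\alpha}$ and $X_{-\alpha}\in(\mathfrak g^{\mathbb C})_{-\alpha}$ such that $H_\alpha=[X_\alpha,X_{-\alpha}]$ satisfies $[H_\alpha,X_{\pm\alpha}]=\pm2X_{\pm\alpha}$; let $w_\alpha:\lambda\mapsto\lambda-\lambda(H_\alpha)\alpha$ be the reflection in $\alpha$, and put $$w_{\alpha,\rho}=e^{\rho^{\mathbb C}(X_\alpha)}\,e^{-\rho^{\mathbb C}(X_{-\alpha})}\,e^{\rho^{\mathbb C}(X_\alpha)}\in \mathrm{GL}(V^{\mathbb C}).$$ Let $\beta_1,\dots,\beta_l$ be simple roots such that $w_{\beta_1}\cdots w_{\beta_l}(R^+)=\{\alpha^\sigma\mid\alpha\in R^+\}$, where $\alpha^\sigma(H)=\overline{\alpha(\sigma(H))}$ for $H\in\mathfrak c^{\mathbb C}$, and put $\omega_\rho=w_{\beta_1,\rho}\cdots w_{\beta_l,\rho}$. Let $M$ be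 an irreducible $\mathfrak g^{\mathbb C}$-invariant subspace of $V^{\mathbb C}$ and $v\in M$ a high weight vector. Then $$M\cap\overline M\neq 0\quad\Longleftrightarrow\quad v\wedge\omega_\rho^{-1}\overline v=0 .$$ In that case $M=\overline M$, the space $M_\sigma$ of real points of $M$ is an irreducible $\mathfrak g$-invariant subspace of $V$, and $$M=\langle G_\rho^{\mathbb C}v\rangle=\langle G_\rho^{\mathbb C}\overline v\rangle=\langle G_\rho^{\mathbb C}\,\omega_\rho^{-1}\overline v\rangle .$$ -/

import Mathlib

open scoped TensorProduct

noncomputable section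

namespace RealRep

/-! ## Complexification and conjugation -/

section Conjugation

variable {W : Type*} [AddCommGroup W] [Module ℝ W]

/-- The conjugation `σ` of `W^ℂ = ℂ ⊗ W`, given by `σ (z ⊗ w) = z̄ ⊗ w`, as a conjugate-linear map. -/
def conj : (ℂ ⊗[ℝ] W) →ₛₗ[starRingEnd ℂ] (ℂ ⊗[ℝ] W) where
  toFun := TensorProduct.map Complex.conjAe.toLinearMap LinearMap.id
  map_add' := map_add _
  map_smul' := by
    intro a x
    induction x using TensorProduct.induction_on with
    | zero => simp
    | tmul z w => simp [TensorProduct.smul_tmul']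
    | add x y hx hy => rw [smul_add, map_add, hx, hy, map_add, smul_add]

@[simp]
theorem conj_tmul (z : ℂ) (w : W) :
    conj (z ⊗ₜ[ℝ] w) = (starRingEnd ℂ z) ⊗ₜ[ℝ] w := rfl

@[simp]
theorem conj_conj (x : ℂ ⊗[ℝ] W) : conj (conj x) = x := by
  induction x using TensorProduct.induction_on with
  | zero => simp
  | tmul z w => simp
  | add x y hx hy => rw [map_add, map_add, hx, hy]

/-- The conjugate `M̄ = σ(M)` of a complex subspace `M` of `W^ℂ`. -/
def conjSubmodule (M : Submodule ℂ (ℂ ⊗[ℝ] W)) : Submodule ℂ (ℂ ⊗[ℝ] W) :=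
  M.map (conj (W := W))

end Conjugation

/-! ## The exponential of an endomorphism -/

section Exponential

variable {W : Type*} [AddCommGroup W] [Module ℂ W] [Module.Finite ℂ W]

/-- The exponential of an endomorphism of a finite dimensional complex vector space: the
exponential series of its matrix in a basis. -/
def expEnd (A : Module.End ℂ W) : Module.End ℂ W :=
  (LinearMap.toMatrixAlgEquiv (Module.finBasis ℂ W)).symm
    (NormedSpace.exp (LinearMap.toMatrixAlgEquiv (Module.finBasis ℂ W) A))

theorem expEnd_mul_expEnd_neg (A : Module.End ℂ W) : expEnd A * expEnd (-A) = 1 := by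
  unfold expEnd
  set B := LinearMap.toMatrixAlgEquiv (Module.finBasis ℂ W) A
  have h : Commute B (-B) := (Commute.refl B).neg_right
  rw [← map_mul, map_neg, ← Matrix.exp_add_of_commute _ _ h, add_neg_cancel, NormedSpace.exp_zero,
    map_one]

/-- `exp A` as an element of `GL(W)`, with inverse `exp (-A)`. -/
def expGL (A : Module.End ℂ W) : LinearMap.GeneralLinearGroup ℂ W where
  val := expEnd A
  inv := expEnd (-A)
  val_inv := expEnd_mul_expEnd_neg A
  inv_val := by simpa using expEnd_mul_expEnd_neg (-A)

/-- `⟨G w⟩`, the complex linear span of the orbit of `w` under a subgroup `G` of `GL(W)`. -/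
def orbitSpan (G : Subgroup (LinearMap.GeneralLinearGroup ℂ W)) (w : W) : Submodule ℂ W :=
  Submodule.span ℂ {x | ∃ g ∈ G, x = (g : Module.End ℂ W) w}

end Exponential

/-! ## Cartan subalgebras, roots, positive systems -/

section Roots

variable {g : Type*} [LieRing g] [LieAlgebra ℝ g]

/-- Cartan subalgebras of `g`: maximal abelian subalgebras whose elements act diagonalizably on the
complexification `g^ℂ`. -/
structure IsCartan (c : LieSubalgebra ℝ g) : Prop where
  maximal_abelian : Maximal (fun s : LieSubalgebra ℝ g => IsLieAbelian s) c
  diagonalizable : ∀ h ∈ c,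
    ⨆ μ : ℂ, Module.End.eigenspace (LieAlgebra.ad ℂ (ℂ ⊗[ℝ] g) ((1 : ℂ) ⊗ₜ[ℝ] h)) μ = ⊤

/-- The complexification `c^ℂ`, as a complex subspace of `g^ℂ`. -/
abbrev complexify (c : LieSubalgebra ℝ g) : Submodule ℂ (ℂ ⊗[ℝ] g) := c.toSubmodule.baseChange ℂ

variable (c : LieSubalgebra ℝ g)

theorem conj_mem_complexify {x : ℂ ⊗[ℝ] g} (hx : x ∈ complexify c) : conj x ∈ complexify c := by
  rw [complexify, Submodule.baseChange_eq_span] at hx ⊢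
  induction hx using Submodule.span_induction with
  | mem x h =>
    obtain ⟨y, hy, rfl⟩ := h
    exact Submodule.subset_span ⟨y, hy, by simp⟩
  | zero => simp
  | add x y _ _ hx hy => rw [map_add]; exact Submodule.add_mem _ hx hy
  | smul a x _ hx => rw [LinearMap.map_smulₛₗ]; exact Submodule.smul_mem _ _ hx

/-- For a complex linear function `l` on `c^ℂ`, the complex linear function `l^σ` given by
`l^σ (H) = conj (l (σ H))`. -/
def conjDual (l : Module.Dual ℂ (complexify c)) : Module.Dual ℂ (complexify c) where
  toFun H := starRingEnd ℂ (l ⟨conj (H : ℂ ⊗[ℝ] g), conj_mem_complexify c H.2⟩)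
  map_add' x y := by
    rw [← map_add, ← map_add]
    congr 2
    exact Subtype.ext (map_add conj (x : ℂ ⊗[ℝ] g) y)
  map_smul' a x := by
    have h : (⟨conj ((a • x : complexify c) : ℂ ⊗[ℝ] g), conj_mem_complexify c (a • x).2⟩ :
        complexify c) = (starRingEnd ℂ a) •
          ⟨conj (x : ℂ ⊗[ℝ] g), conj_mem_complexify c x.2⟩ :=
      Subtype.ext (LinearMap.map_smulₛₗ conj a (x : ℂ ⊗[ℝ] g))
    rw [h, map_smul]
    simp

/-- The adjoint representation of `g^ℂ`: `adC x y = [x, y]`. -/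
abbrev adC (x : ℂ ⊗[ℝ] g) : Module.End ℂ (ℂ ⊗[ℝ] g) := LieAlgebra.ad ℂ (ℂ ⊗[ℝ] g) x

/-- The space `(g^ℂ)_l` of all `x` with `[H, x] = l(H) x` for all `H` in `c^ℂ`. -/
def rootSpace (l : Module.Dual ℂ (complexify c)) : Submodule ℂ (ℂ ⊗[ℝ] g) where
  carrier := {x | ∀ H : complexify c, adC (H : ℂ ⊗[ℝ] g) x = l H • x}
  add_mem' := by
    intro x y hx hy H
    rw [map_add, hx H, hy H, smul_add]
  zero_mem' := by
    intro H
    rw [map_zero, smul_zero]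
  smul_mem' := by
    intro a x hx H
    rw [map_smul, hx H, smul_comm]

/-- The set `R` of roots of `c^ℂ` in `g^ℂ`. -/
def roots : Set (Module.Dual ℂ (complexify c)) :=
  {l | l ≠ 0 ∧ rootSpace c l ≠ ⊥}

/-- A notion of positivity on the complex linear functions on `c^ℂ`, that is, the cone of positive
elements of a translation invariant total order. The lexicographic order with respect to an ordered
basis of `c` is an example. -/
structure IsPositiveCone (C : Set (Module.Dual ℂ (complexify c))) : Prop where
  zero_notMem : (0 : Module.Dual ℂ (complexify c)) ∉ C
  add_mem : ∀ l ∈ C, ∀ m ∈ C, l + m ∈ C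
  mem_or_neg_mem : ∀ l, l ≠ 0 → l ∈ C ∨ -l ∈ C

/-- `P` is a positive system of roots: the roots that are positive in some total order. -/
def IsPositiveSystem (P : Set (Module.Dual ℂ (complexify c))) : Prop :=
  ∃ C, IsPositiveCone c C ∧ P = roots c ∩ C

/-- The simple roots of a positive system: positive roots that are not a sum of two positive
roots. -/
def simpleRoots (P : Set (Module.Dual ℂ (complexify c))) : Set (Module.Dual ℂ (complexify c)) :=
  {α | α ∈ P ∧ ¬ ∃ β ∈ P, ∃ γ ∈ P, α = β + γ}

/-- The span `𝔶` of all root vectors of positive roots, that is, the nil-radical of the Borel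
subalgebra `c^ℂ + 𝔶` determined by `P`. -/
def nilradical (P : Set (Module.Dual ℂ (complexify c))) : Submodule ℂ (ℂ ⊗[ℝ] g) :=
  ⨆ α ∈ P, rootSpace c α

/-- For each simple root `α`, a standard copy of `sl(2, ℂ)` in `g^ℂ`, with root vectors `X α` and
`Y α` of the roots `α` and `-α`, and with `H α = [X α, Y α]` in `c^ℂ`. -/
structure StandardTriples (P : Set (Module.Dual ℂ (complexify c))) where
  X : Module.Dual ℂ (complexify c) → ℂ ⊗[ℝ] g
  Y : Module.Dual ℂ (complexify c) → ℂ ⊗[ℝ] g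
  H : Module.Dual ℂ (complexify c) → complexify c
  X_mem : ∀ α ∈ simpleRoots c P, X α ∈ rootSpace c α
  Y_mem : ∀ α ∈ simpleRoots c P, Y α ∈ rootSpace c (-α)
  lie_X_Y : ∀ α ∈ simpleRoots c P, adC (X α) (Y α) = (H α : ℂ ⊗[ℝ] g)
  lie_H_X : ∀ α ∈ simpleRoots c P, adC (H α : ℂ ⊗[ℝ] g) (X α) = (2 : ℂ) • X α
  lie_H_Y : ∀ α ∈ simpleRoots c P, adC (H α : ℂ ⊗[ℝ] g) (Y α) = (-2 : ℂ) • Y α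

variable {c}
variable {P : Set (Module.Dual ℂ (complexify c))}

/-- The simple reflection `w_α : l ↦ l - l(H_α) α` on the complex linear functions on `c^ℂ`. -/
def reflection (T : StandardTriples c P) (α : Module.Dual ℂ (complexify c)) :
    Module.End ℂ (Module.Dual ℂ (complexify c)) :=
  Module.preReflection α (Module.Dual.eval ℂ (complexify c) (T.H α))

/-- `β₁, …, β_l` is a sequence of simple roots such that `ω = w_{β₁} ⋯ w_{β_l}` carries the positive
system `P` to its conjugate `{α^σ | α ∈ P}`. -/
structure IsConjugatingWord (T : StandardTriples c P)
    (β : List (Module.Dual ℂ (complexify c))) : Prop where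
  simple : ∀ α ∈ β, α ∈ simpleRoots c P
  image_eq : (β.map (reflection T)).prod '' P = conjDual c '' P

end Roots

/-! ## Representations -/

section Representations

variable {g : Type*} [LieRing g] [LieAlgebra ℝ g]
variable (V : Type*) [AddCommGroup V] [Module ℝ V] [LieRingModule g V] [LieModule ℝ g V]

/-- The complexification `ρ^ℂ : g^ℂ → gl(V^ℂ)` of the representation `ρ` of `g` on `V`. -/
abbrev rhoC (x : ℂ ⊗[ℝ] g) : Module.End ℂ (ℂ ⊗[ℝ] V) :=
  LieModule.toEnd ℂ (ℂ ⊗[ℝ] g) (ℂ ⊗[ℝ] V) x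

section Group

variable [Module.Finite ℝ V]

variable (g) in
/-- `G_ρ^ℂ`: the subgroup of `GL(V^ℂ)` generated by all `exp (z ρ(X))`, `z ∈ ℂ`, `X ∈ g`. -/
def complexGroup : Subgroup (LinearMap.GeneralLinearGroup ℂ (ℂ ⊗[ℝ] V)) :=
  Subgroup.closure {a | ∃ (z : ℂ) (X : g), a = expGL (z • rhoC V ((1 : ℂ) ⊗ₜ[ℝ] X))}

variable {c : LieSubalgebra ℝ g} {P : Set (Module.Dual ℂ (complexify c))}

/-- `w_{α,ρ} = exp(ρ(X_α)) exp(-ρ(Y_α)) exp(ρ(X_α))`. -/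
def simpleRep (T : StandardTriples c P) (α : Module.Dual ℂ (complexify c)) :
    LinearMap.GeneralLinearGroup ℂ (ℂ ⊗[ℝ] V) :=
  expGL (rhoC V (T.X α)) * expGL (-rhoC V (T.Y α)) * expGL (rhoC V (T.X α))

/-- `ω_ρ = w_{β₁,ρ} ⋯ w_{β_l,ρ}`. -/
def omegaRep (T : StandardTriples c P) (β : List (Module.Dual ℂ (complexify c))) :
    LinearMap.GeneralLinearGroup ℂ (ℂ ⊗[ℝ] V) :=
  (β.map (simpleRep V T)).prod

end Group

variable {V}

/-- High weight vectors of `V^ℂ` relative to `(𝔶, c^ℂ)`. -/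
structure IsHighWeightVector (c : LieSubalgebra ℝ g) (P : Set (Module.Dual ℂ (complexify c)))
    (v : ℂ ⊗[ℝ] V) : Prop where
  ne_zero : v ≠ 0
  nilradical_lie : ∀ x ∈ nilradical c P, rhoC V x v = 0
  exists_weight : ∃ l : Module.Dual ℂ (complexify c),
    ∀ H : complexify c, rhoC V (H : ℂ ⊗[ℝ] g) v = l H • v

/-- The real points `M_σ` of a `g^ℂ`-invariant subspace `M` of `V^ℂ`, as a `g`-invariant subspace
of `V` (where `x ∈ V` is identified with `1 ⊗ x ∈ V^ℂ`). -/
def realPoints (M : LieSubmodule ℂ (ℂ ⊗[ℝ] g) (ℂ ⊗[ℝ] V)) : LieSubmodule ℝ g V where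
  carrier := {x | (1 : ℂ) ⊗ₜ[ℝ] x ∈ M}
  add_mem' := by
    intro x y hx hy
    simp only [Set.mem_ofPred_eq, TensorProduct.tmul_add] at *
    exact add_mem hx hy
  zero_mem' := by simp
  smul_mem' := by
    intro a x hx
    have h : (1 : ℂ) ⊗ₜ[ℝ] (a • x) = (a : ℂ) • ((1 : ℂ) ⊗ₜ[ℝ] x) := by
      rw [← TensorProduct.smul_tmul, TensorProduct.smul_tmul']
      simp
    simp only [Set.mem_ofPred_eq] at *
    rw [h]
    exact M.smul_mem _ hx
  lie_mem := by
    intro X x hx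
    have h := M.lie_mem (x := (1 : ℂ) ⊗ₜ[ℝ] X) hx
    simpa using h

/-- The real points of `M` are exactly the fixed points of the conjugation in `M`. -/
theorem image_realPoints (M : LieSubmodule ℂ (ℂ ⊗[ℝ] g) (ℂ ⊗[ℝ] V)) :
    (fun x : V => (1 : ℂ) ⊗ₜ[ℝ] x) '' (realPoints M : Set V) = {m | m ∈ M ∧ conj m = m} := by
  ext m
  constructor
  · rintro ⟨x, hx, rfl⟩
    exact ⟨hx, by simp⟩
  · rintro ⟨hm, hc⟩
    have key : ∀ y : ℂ ⊗[ℝ] V, ∃ x : V, y + conj y = (1 : ℂ) ⊗ₜ[ℝ] x := by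
      intro y
      induction y using TensorProduct.induction_on with
      | zero => exact ⟨0, by simp⟩
      | tmul z w =>
        refine ⟨(2 * z.re) • w, ?_⟩
        rw [conj_tmul, ← TensorProduct.add_tmul, Complex.add_conj, ← TensorProduct.smul_tmul]
        simp
      | add a b ha hb =>
        obtain ⟨x, hx⟩ := ha
        obtain ⟨x', hx'⟩ := hb
        exact ⟨x + x', by rw [map_add, TensorProduct.tmul_add, ← hx, ← hx']; abel⟩
    obtain ⟨x, hx⟩ := key ((2 : ℂ)⁻¹ • m)
    have hm' : m = (1 : ℂ) ⊗ₜ[ℝ] x := by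
      rw [← hx, LinearMap.map_smulₛₗ, hc, ← add_smul]
      have : (2 : ℂ)⁻¹ + (starRingEnd ℂ) (2 : ℂ)⁻¹ = 1 := by
        rw [map_inv₀, Complex.conj_ofNat]; norm_num
      rw [this, one_smul]
    refine ⟨x, ?_, hm'.symm⟩
    change (1 : ℂ) ⊗ₜ[ℝ] x ∈ M
    rw [← hm']
    exact hm

end Representations

end RealRep

end

/-! The core is that an irreducible module has only one high weight vector up to scale. Let `K` be
the smallest subspace that contains `v` and is stable under negative root vectors. Commuting an
arbitrary element past a negative root vector shows that `K` is invariant under the whole algebra,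
so it contains `M`. Hence `M` lies in the line of `v` plus the weight spaces strictly below the
weight of `v`. Two high weight vectors that were not proportional would each have weight strictly
below the other (`IsHighWeightVector.exists_eq_smul`).

The vector `v̄` is a high weight vector for the conjugate positive system. Conjugation by `ω_ρ`
covers an automorphism of `g^ℂ` that carries the root spaces of `R⁺` to those of the conjugate
system, so `u = ω_ρ⁻¹ v̄` is again a high weight vector for `R⁺`
(`IsHighWeightVector.omega_inv_conj`). It lies in `M̄`, because exponentials of `ρ^ℂ(g^ℂ)` preserve
invariant subspaces.

If `M` meets `M̄`, irreducibility gives `M = M̄`, so `u` and `v` are high weight vectors of the same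
irreducible module and are proportional. Conversely, if `u` is a multiple of `v`, then `u` is a
nonzero vector of `M ∩ M̄`. Orbit spans are `g^ℂ`-invariant by differentiating one parameter groups.
A nonzero invariant subspace of `M_σ` complexifies to an invariant subspace containing `M`. -/

noncomputable section

namespace RealRep

/-! ### Exponentials of endomorphisms, tested against linear functionals -/

section Exponential

variable {W : Type*} [AddCommGroup W] [Module ℂ W] [Module.Finite ℂ W]

section

attribute [local instance] Matrix.linftyOpNormedRing Matrix.linftyOpNormedAlgebra

/-- The exponential series of `A`, applied to a vector and paired with a functional. -/
theorem hasSum_expEnd (A : Module.End ℂ W) (f : Module.Dual ℂ W) (w : W) :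
    HasSum (fun n : ℕ => ((n.factorial : ℂ)⁻¹) * f ((A ^ n) w)) (f (expEnd A w)) := by
  set e := LinearMap.toMatrixAlgEquiv (Module.finBasis ℂ W)
  have h := NormedSpace.exp_series_hasSum_exp' (𝕂 := ℂ) (e A)
  let L : Matrix _ _ ℂ →ₗ[ℂ] ℂ :=
    f ∘ₗ LinearMap.applyₗ w ∘ₗ e.symm.toLinearMap
  have h2 := h.mapL (LinearMap.toContinuousLinearMap L)
  have hn : ∀ n : ℕ, L (((n.factorial : ℂ)⁻¹) • e A ^ n)
      = ((n.factorial : ℂ)⁻¹) * f ((A ^ n) w) := fun n => by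
    rw [map_smul, ← map_pow, smul_eq_mul]
    simp [L]
  exact (funext hn : (fun n : ℕ => L (((n.factorial : ℂ)⁻¹) • e A ^ n)) = _) ▸ h2

theorem hasDerivAt_expEnd (A : Module.End ℂ W) (f : Module.Dual ℂ W) (w : W) :
    HasDerivAt (fun z : ℂ => f (expEnd (z • A) w)) (f (A w)) 0 := by
  set e := LinearMap.toMatrixAlgEquiv (Module.finBasis ℂ W)
  let L : Matrix _ _ ℂ →ₗ[ℂ] ℂ :=
    f ∘ₗ LinearMap.applyₗ w ∘ₗ e.symm.toLinearMap
  have h := hasDerivAt_exp_smul_const (𝕂 := ℂ) (e A) (0 : ℂ)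
  have h2 := (LinearMap.toContinuousLinearMap L).hasFDerivAt.comp_hasDerivAt (0 : ℂ) h
  have h3 : ∀ z : ℂ, L (NormedSpace.exp (z • e A)) = f (expEnd (z • A) w) := fun z => by
    rw [← map_smul]; rfl
  have h4 : L (NormedSpace.exp ((0 : ℂ) • e A) * e A) = f (A w) := by
    rw [zero_smul, NormedSpace.exp_zero, one_mul]
    simp [L]
  have h5 : HasDerivAt (fun z : ℂ => L (NormedSpace.exp (z • e A)))
      (L (NormedSpace.exp ((0 : ℂ) • e A) * e A)) 0 := h2
  rw [h4] at h5
  exact (funext h3) ▸ h5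

end

theorem dual_ext {x y : W} (h : ∀ f : Module.Dual ℂ W, f x = f y) : x = y :=
  Module.forall_dual_apply_eq_zero_iff ℂ (x - y) |>.mp (fun f => by simp [h f]) |> sub_eq_zero.mp

theorem mem_of_forall_dual {N : Submodule ℂ W} {x : W}
    (h : ∀ f : Module.Dual ℂ W, (∀ y ∈ N, f y = 0) → f x = 0) : x ∈ N := by
  by_contra hx
  obtain ⟨f, hf, hN⟩ := Submodule.exists_dual_map_eq_bot_of_notMem hx inferInstance
  refine hf (h f fun y hy => ?_)
  have : f y ∈ N.map f := ⟨y, hy, rfl⟩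
  rwa [hN] at this

/-- An invariant subspace is invariant under the exponential. -/
theorem expEnd_mem {A : Module.End ℂ W} {N : Submodule ℂ W} (hA : ∀ y ∈ N, A y ∈ N) {w : W}
    (hw : w ∈ N) : expEnd A w ∈ N := by
  have hp : ∀ n : ℕ, (A ^ n) w ∈ N := fun n => by
    induction n with
    | zero => simpa
    | succ n ih => rw [pow_succ', Module.End.mul_apply]; exact hA _ ih
  refine mem_of_forall_dual fun f hf => ?_
  refine (hasSum_expEnd A f w).unique ?_
  simp [hf _ (hp _)]

/-- A subspace that is invariant under a one parameter group is invariant under its generator. -/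
theorem apply_mem_of_expEnd_mem {A : Module.End ℂ W} {N : Submodule ℂ W} {w : W}
    (h : ∀ z : ℂ, expEnd (z • A) w ∈ N) : A w ∈ N := by
  refine mem_of_forall_dual fun f hf => ?_
  refine (hasDerivAt_expEnd A f w).unique ?_
  simpa [hf _ (h _)] using hasDerivAt_const (0 : ℂ) (0 : ℂ)

/-- The two exponential series agree term by term after applying a functional, so no topology on `W`
or `W'` is needed. -/
theorem expEnd_intertwine {W' : Type*} [AddCommGroup W'] [Module ℂ W'] [Module.Finite ℂ W']
    {A : Module.End ℂ W} {B : Module.End ℂ W'} (T : W →ₗ[ℂ] W') (h : ∀ w, T (A w) = B (T w))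
    (w : W) : T (expEnd A w) = expEnd B (T w) := by
  have hp : ∀ n : ℕ, T ((A ^ n) w) = (B ^ n) (T w) := fun n => by
    induction n with
    | zero => simp
    | succ n ih => rw [pow_succ', pow_succ', Module.End.mul_apply, Module.End.mul_apply, h, ih]
  refine dual_ext fun f => (hasSum_expEnd A (f ∘ₗ T) w).unique ?_
  simpa [hp] using hasSum_expEnd B f (T w)

/-- Only the orbit of the single vector `w` has to terminate; `A` itself need not be nilpotent. -/
theorem expEnd_apply_of_cube {A : Module.End ℂ W} {w : W} (h : A (A (A w)) = 0) :
    expEnd A w = w + A w + (2 : ℂ)⁻¹ • A (A w) := by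
  have hp : ∀ n : ℕ, (A ^ (n + 3)) w = 0 := fun n => by
    rw [pow_add, Module.End.mul_apply, pow_succ, pow_two]
    simp [Module.End.mul_apply, h]
  refine dual_ext fun f => (hasSum_expEnd A f w).unique ?_
  have : HasSum (fun n : ℕ => ((n.factorial : ℂ)⁻¹) * f ((A ^ n) w)) _ :=
    hasSum_sum_of_ne_finset_zero (s := Finset.range 3) (fun n hn => by
      obtain ⟨k, rfl⟩ := Nat.exists_eq_add_of_le' (not_lt.mp ((Finset.mem_range (m := n)).not.mp hn))
      simp [hp])
  simpa [Finset.sum_range_succ, pow_two, Nat.factorial] using this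

theorem expEnd_add_of_commute {A B : Module.End ℂ W} (h : Commute A B) :
    expEnd (A + B) = expEnd A * expEnd B := by
  unfold expEnd
  rw [← map_mul, map_add, Matrix.exp_add_of_commute]
  exact h.map (LinearMap.toMatrixAlgEquiv (Module.finBasis ℂ W))

theorem expEnd_mulLeft (A B : Module.End ℂ W) :
    expEnd (LinearMap.mulLeft ℂ A) B = expEnd A * B := by
  ext w
  exact expEnd_intertwine (A := LinearMap.mulLeft ℂ A) (B := A)
    (LinearMap.applyₗ w : Module.End ℂ W →ₗ[ℂ] W) (fun B => by simp) B

/-- Evaluation at a vector does not intertwine right multiplication with an endomorphism of `W`, so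
the series are compared directly. -/
theorem expEnd_mulRight (A B : Module.End ℂ W) :
    expEnd (LinearMap.mulRight ℂ A) B = B * expEnd A := by
  ext w
  refine dual_ext fun f =>
    (hasSum_expEnd (LinearMap.mulRight ℂ A)
      (f ∘ₗ (LinearMap.applyₗ w : Module.End ℂ W →ₗ[ℂ] W)) B).unique ?_
  simpa [LinearMap.pow_mulRight] using hasSum_expEnd A (f ∘ₗ B) w

/-- `exp(A) B = (exp(ad A) B) exp(A)`. -/
theorem expEnd_mul (A B : Module.End ℂ W) :
    expEnd A * B
      = expEnd (LinearMap.mulLeft ℂ A + LinearMap.mulRight ℂ (-A)) B * expEnd A := by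
  -- Here `ad A` is the sum of the commuting left multiplication by `A` and right multiplication by
  -- `-A`, whence `exp(ad A) B = exp(A) B exp(-A)`.
  have hc : Commute (LinearMap.mulLeft ℂ A) (LinearMap.mulRight ℂ (-A)) :=
    LinearMap.commute_mulLeft_right A (-A)
  have := expEnd_mul_expEnd_neg (-A)
  rw [neg_neg] at this
  rw [expEnd_add_of_commute hc, Module.End.mul_apply, expEnd_mulRight, expEnd_mulLeft,
    mul_assoc, mul_assoc, this, mul_one]

end Exponential

/-! ### Real and imaginary parts in a complexification -/

section Conjugation

variable {W : Type*} [AddCommGroup W] [Module ℝ W]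

theorem exists_real_parts (x : ℂ ⊗[ℝ] W) :
    ∃ a b : W, x = (1 : ℂ) ⊗ₜ[ℝ] a + Complex.I • ((1 : ℂ) ⊗ₜ[ℝ] b) := by
  induction x using TensorProduct.induction_on with
  | zero => exact ⟨0, 0, by simp⟩
  | tmul z w =>
    refine ⟨z.re • w, z.im • w, ?_⟩
    rw [TensorProduct.smul_tmul', ← TensorProduct.smul_tmul, ← TensorProduct.smul_tmul,
      ← TensorProduct.add_tmul]
    congr 1
    apply Complex.ext <;> simp
  | add x y hx hy =>
    obtain ⟨a, b, rfl⟩ := hx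
    obtain ⟨a', b', rfl⟩ := hy
    refine ⟨a + a', b + b', ?_⟩
    simp only [TensorProduct.tmul_add, smul_add]
    abel

theorem real_parts_eq_zero {a b : W}
    (h : (1 : ℂ) ⊗ₜ[ℝ] a + Complex.I • ((1 : ℂ) ⊗ₜ[ℝ] b) = 0) : a = 0 ∧ b = 0 := by
  have hre := congrArg (fun x => TensorProduct.lid ℝ W (TensorProduct.map Complex.reLm .id x)) h
  have him := congrArg (fun x => TensorProduct.lid ℝ W (TensorProduct.map Complex.imLm .id x)) h
  simp only [TensorProduct.smul_tmul', map_add, TensorProduct.map_tmul, map_zero,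
    TensorProduct.lid_tmul] at hre him
  simp at hre him
  exact ⟨hre, him⟩

theorem mem_conjSubmodule {M : Submodule ℂ (ℂ ⊗[ℝ] W)} {x : ℂ ⊗[ℝ] W} :
    x ∈ conjSubmodule M ↔ conj x ∈ M := by
  constructor
  · rintro ⟨y, hy, rfl⟩
    rwa [conj_conj]
  · exact fun h => ⟨_, h, conj_conj x⟩

end Conjugation

/-! ### Joint eigenvectors and diagonalizability -/

section LinearAlgebra

variable {W : Type*} [AddCommGroup W] [Module ℂ W]

/-- A joint eigenvector of a linear family of endomorphisms has a linear eigenvalue. -/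
theorem exists_dual_of_forall_exists_smul {S : Type*} [AddCommGroup S] [Module ℂ S]
    (F : S →ₗ[ℂ] Module.End ℂ W) {x : W} (hx : x ≠ 0) (h : ∀ s, ∃ a : ℂ, F s x = a • x) :
    ∃ l : Module.Dual ℂ S, ∀ s, F s x = l s • x := by
  choose a ha using h
  have hinj : Function.Injective fun z : ℂ => z • x := smul_left_injective ℂ hx
  refine ⟨⟨⟨a, fun s t => hinj ?_⟩, fun z s => hinj ?_⟩, ha⟩
  · simp only [← ha, map_add, LinearMap.add_apply, add_smul]
  · simp only [← ha, map_smul, LinearMap.smul_apply, RingHom.id_apply, smul_eq_mul, mul_smul]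

/-- Split a generalized eigenvector into its `μ`-eigenvector part and the rest. The rest is again
generalized for `μ`, and vanishes by independence of the generalized eigenspaces. -/
theorem maxGenEigenspace_le_eigenspace_of_iSup_eq_top {f : Module.End ℂ W}
    (h : ⨆ μ : ℂ, f.eigenspace μ = ⊤) (μ : ℂ) : f.maxGenEigenspace μ ≤ f.eigenspace μ := by
  intro x hx
  have hle : ∀ ν, f.eigenspace ν ≤ f.maxGenEigenspace ν :=
    fun ν => f.genEigenspace_le_maximal ν 1
  have hx' : x ∈ f.eigenspace μ ⊔ ⨆ ν, ⨆ _ : ν ≠ μ, f.eigenspace ν := by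
    have hle' : ⨆ ν, f.eigenspace ν ≤ f.eigenspace μ ⊔ ⨆ ν, ⨆ _ : ν ≠ μ, f.eigenspace ν := by
      refine iSup_le fun ν => ?_
      rcases eq_or_ne ν μ with rfl | hν
      · exact le_sup_left
      · exact le_sup_of_le_right (le_iSup₂_of_le ν hν le_rfl)
    exact hle' (h ▸ Submodule.mem_top)
  obtain ⟨e, he, r, hr, rfl⟩ := Submodule.mem_sup.mp hx'
  have hr' : r ∈ f.maxGenEigenspace μ := by
    simpa using sub_mem hx (hle μ he)
  have hd := f.independent_maxGenEigenspace μ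
  have : r = 0 := Submodule.disjoint_def.mp hd r hr'
    ((iSup₂_mono fun ν _ => hle ν) hr)
  simpa [this] using he

end LinearAlgebra

/-! ### Root space decomposition for a Cartan subalgebra -/

section Roots

section

variable {g : Type*} [LieRing g] [LieAlgebra ℝ g]
variable {V : Type*} [AddCommGroup V] [Module ℝ V] [LieRingModule g V] [LieModule ℝ g V]

theorem adC_swap (x y : ℂ ⊗[ℝ] g) : adC x y = -adC y x := (lie_skew x y).symm

theorem adC_tmul (z w : ℂ) (x y : g) :
    adC (z ⊗ₜ[ℝ] x) (w ⊗ₜ[ℝ] y) = (z * w) ⊗ₜ[ℝ] ⁅x, y⁆ := rfl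

theorem rhoC_tmul (z w : ℂ) (x : g) (y : V) :
    rhoC V (z ⊗ₜ[ℝ] x) (w ⊗ₜ[ℝ] y) = (z * w) ⊗ₜ[ℝ] ⁅x, y⁆ := rfl

theorem rhoC_add (x y : ℂ ⊗[ℝ] g) : rhoC V (x + y) = rhoC V x + rhoC V y :=
  map_add (LieModule.toEnd ℂ (ℂ ⊗[ℝ] g) (ℂ ⊗[ℝ] V)) x y

theorem rhoC_zero : rhoC V (0 : ℂ ⊗[ℝ] g) = 0 :=
  map_zero (LieModule.toEnd ℂ (ℂ ⊗[ℝ] g) (ℂ ⊗[ℝ] V))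

theorem rhoC_smul (a : ℂ) (x : ℂ ⊗[ℝ] g) : rhoC V (a • x) = a • rhoC V x :=
  map_smul (LieModule.toEnd ℂ (ℂ ⊗[ℝ] g) (ℂ ⊗[ℝ] V)) a x

theorem rhoC_neg (x : ℂ ⊗[ℝ] g) : rhoC V (-x) = -rhoC V x :=
  map_neg (LieModule.toEnd ℂ (ℂ ⊗[ℝ] g) (ℂ ⊗[ℝ] V)) x

theorem adC_neg (x : ℂ ⊗[ℝ] g) : adC (-x) = -adC x :=
  map_neg (LieAlgebra.ad ℂ (ℂ ⊗[ℝ] g)) x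

theorem adC_zero : adC (0 : ℂ ⊗[ℝ] g) = 0 :=
  map_zero (LieAlgebra.ad ℂ (ℂ ⊗[ℝ] g))

theorem rhoC_rhoC (x y : ℂ ⊗[ℝ] g) (m : ℂ ⊗[ℝ] V) :
    rhoC V x (rhoC V y m) = rhoC V (adC x y) m + rhoC V y (rhoC V x m) :=
  leibniz_lie x y m

theorem adC_adC (x y z : ℂ ⊗[ℝ] g) :
    adC x (adC y z) = adC (adC x y) z + adC y (adC x z) :=
  leibniz_lie x y z

end

variable {g : Type*} [LieRing g] [LieAlgebra ℝ g] {c : LieSubalgebra ℝ g}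

theorem tmul_mem_complexify {h : g} (hh : h ∈ c) : (1 : ℂ) ⊗ₜ[ℝ] h ∈ complexify c :=
  Submodule.tmul_mem_baseChange_of_mem 1 hh

/-- A property of elements of `c^ℂ` may be checked on `c`. -/
theorem complexify_induction {S : Submodule ℂ (ℂ ⊗[ℝ] g)}
    (h : ∀ x ∈ c, (1 : ℂ) ⊗ₜ[ℝ] x ∈ S) : complexify c ≤ S := by
  rw [complexify, Submodule.baseChange_eq_span, Submodule.span_le]
  rintro _ ⟨y, hy, rfl⟩
  exact h y hy

theorem IsCartan.lie_eq_zero (hc : IsCartan c) {x y : g} (hx : x ∈ c) (hy : y ∈ c) :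
    ⁅x, y⁆ = 0 := by
  have := hc.maximal_abelian.prop
  exact congrArg Subtype.val (trivial_lie_zero c c ⟨x, hx⟩ ⟨y, hy⟩)

theorem IsCartan.lie_complexify (hc : IsCartan c) {x y : ℂ ⊗[ℝ] g} (hx : x ∈ complexify c)
    (hy : y ∈ complexify c) : adC x y = 0 := by
  have h1 : ∀ a ∈ c, complexify c ≤ LinearMap.ker (adC ((1 : ℂ) ⊗ₜ[ℝ] a)) := fun a ha =>
    complexify_induction fun b hb => by
      rw [LinearMap.mem_ker, adC_tmul, hc.lie_eq_zero ha hb, TensorProduct.tmul_zero]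
  have h2 : complexify c ≤ LinearMap.ker (adC y) := complexify_induction fun a ha => by
    have := h1 a ha hy
    rw [LinearMap.mem_ker] at this ⊢
    rw [adC_swap, this, neg_zero]
  rw [adC_swap, LinearMap.mem_ker.mp (h2 hx), neg_zero]

/-- A maximal abelian subalgebra is its own centralizer. -/
theorem IsCartan.mem_of_lie_eq_zero (hc : IsCartan c) {a : g} (ha : ∀ h ∈ c, ⁅h, a⁆ = 0) :
    a ∈ c := by
  -- Adjoining `a` to `c` gives an abelian subalgebra, which maximality forces back into `c`.
  have hab : ∀ x ∈ c.toSubmodule ⊔ Submodule.span ℝ {a},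
      ∀ y ∈ c.toSubmodule ⊔ Submodule.span ℝ {a}, ⁅x, y⁆ = 0 := by
    intro x hx y hy
    obtain ⟨x, hxc, _, hs, rfl⟩ := Submodule.mem_sup.mp hx
    obtain ⟨y, hyc, _, ht, rfl⟩ := Submodule.mem_sup.mp hy
    obtain ⟨s, rfl⟩ := Submodule.mem_span_singleton.mp hs
    obtain ⟨t, rfl⟩ := Submodule.mem_span_singleton.mp ht
    have h3 : ⁅a, y⁆ = 0 := by rw [← lie_skew, ha y hyc, neg_zero]
    simp [hc.lie_eq_zero hxc hyc, ha x hxc, h3]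
  let d : LieSubalgebra ℝ g :=
    { c.toSubmodule ⊔ Submodule.span ℝ {a} with
      lie_mem' := fun {x y} hx hy => by
        have := hab x hx y hy
        rw [this]
        exact Submodule.zero_mem _ }
  have hd : IsLieAbelian d := ⟨fun x y => Subtype.ext (hab x x.2 y y.2)⟩
  have hle : c ≤ d := fun x hx => Submodule.mem_sup_left (S := c.toSubmodule) hx
  exact hc.maximal_abelian.le_of_ge hd hle
    (Submodule.mem_sup_right (S := c.toSubmodule) (Submodule.mem_span_singleton_self a))

/-- Since `c` is real, the real and imaginary parts of a vector centralizing `c^ℂ` each centralize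
`c`. -/
theorem IsCartan.rootSpace_zero_le (hc : IsCartan c) : rootSpace c 0 ≤ complexify c := by
  intro x hx
  obtain ⟨a, b, rfl⟩ := exists_real_parts x
  have key : ∀ h ∈ c, ⁅h, a⁆ = 0 ∧ ⁅h, b⁆ = 0 := fun h hh => by
    apply real_parts_eq_zero
    have := hx ⟨_, tmul_mem_complexify hh⟩
    simpa using this
  have ha := hc.mem_of_lie_eq_zero fun h hh => (key h hh).1
  have hb := hc.mem_of_lie_eq_zero fun h hh => (key h hh).2
  exact add_mem (tmul_mem_complexify ha) (Submodule.smul_mem _ _ (tmul_mem_complexify hb))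

/-- The root space decomposition. -/
theorem IsCartan.iSup_rootSpace [Module.Finite ℝ g] (hc : IsCartan c) :
    ⨆ l, rootSpace c l = ⊤ := by
  let f : c → Module.End ℂ (ℂ ⊗[ℝ] g) := fun h => adC ((1 : ℂ) ⊗ₜ[ℝ] (h : g))
  have htop := Module.End.iSup_iInf_maxGenEigenspace_eq_top_of_iSup_maxGenEigenspace_eq_top_of_commute
    f (fun h k _ => by
      refine LinearMap.ext fun x => ?_
      have h2 := adC_adC ((1 : ℂ) ⊗ₜ[ℝ] (h : g)) ((1 : ℂ) ⊗ₜ[ℝ] (k : g)) x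
      rwa [adC_tmul, hc.lie_eq_zero h.2 k.2, TensorProduct.tmul_zero, adC_zero,
        LinearMap.zero_apply, zero_add] at h2)
    (fun h => top_le_iff.mp <| (hc.diagonalizable h h.2).ge.trans <|
      iSup_mono fun μ => (f h).genEigenspace_le_maximal μ 1)
  rw [← top_le_iff, ← htop, iSup_le_iff]
  intro χ x hx
  rcases eq_or_ne x 0 with rfl | hx0
  · exact zero_mem _
  have hx' : ∀ h : c, adC ((1 : ℂ) ⊗ₜ[ℝ] (h : g)) x = χ h • x := fun h =>
    Module.End.mem_eigenspace_iff.mp <| maxGenEigenspace_le_eigenspace_of_iSup_eq_top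
      (hc.diagonalizable h h.2) _ ((Submodule.mem_iInf _).mp hx h)
  let A : (ℂ ⊗[ℝ] g) →ₗ[ℂ] Module.End ℂ (ℂ ⊗[ℝ] g) := (LieAlgebra.ad ℂ (ℂ ⊗[ℝ] g) : _ →ₗ[ℂ] _)
  -- The eigenvalues are known only on `c`. Preserving the line of `x` is a complex linear
  -- condition, so it passes to `c^ℂ`, where the eigenvalue is automatically linear.
  have hs : complexify c ≤ (Submodule.span ℂ {x}).comap (A.flip x) :=
    complexify_induction fun h hh =>
      Submodule.mem_span_singleton.mpr ⟨_, (hx' ⟨h, hh⟩).symm⟩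
  obtain ⟨l, hl⟩ := exists_dual_of_forall_exists_smul (A ∘ₗ (complexify c).subtype) hx0
    (fun s => by
      obtain ⟨a, ha⟩ := Submodule.mem_span_singleton.mp (hs s.2)
      exact ⟨a, ha.symm⟩)
  exact le_iSup (rootSpace c) l hl

end Roots

/-! ### Weights and uniqueness of high weight vectors -/

section Representations

variable {g : Type*} [LieRing g] [LieAlgebra ℝ g]
variable {V : Type*} [AddCommGroup V] [Module ℝ V] [LieRingModule g V] [LieModule ℝ g V]

theorem conj_rhoC (x : ℂ ⊗[ℝ] g) (m : ℂ ⊗[ℝ] V) :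
    conj (rhoC V x m) = rhoC V (conj x) (conj m) := by
  induction x using TensorProduct.induction_on with
  | zero => simp only [map_zero, LinearMap.zero_apply]
  | add x y hx hy => simp only [map_add, LinearMap.add_apply, hx, hy]
  | tmul z a =>
    induction m using TensorProduct.induction_on with
    | zero => simp only [map_zero]
    | add x y hx hy => simp only [map_add, hx, hy]
    | tmul w b => simp only [rhoC_tmul, conj_tmul, map_mul]

variable (V) in
/-- The vectors of weight `l` in `V^ℂ`. -/
def weightVectors (c : LieSubalgebra ℝ g) (l : Module.Dual ℂ (complexify c)) :
    Submodule ℂ (ℂ ⊗[ℝ] V) :=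
  ⨅ H : complexify c, (rhoC V (H : ℂ ⊗[ℝ] g)).eigenspace (l H)

variable {c : LieSubalgebra ℝ g}

theorem mem_weightVectors {l : Module.Dual ℂ (complexify c)} {x : ℂ ⊗[ℝ] V} :
    x ∈ weightVectors V c l ↔ ∀ H : complexify c, rhoC V (H : ℂ ⊗[ℝ] g) x = l H • x := by
  simp only [weightVectors, Submodule.mem_iInf, Module.End.mem_eigenspace_iff]

theorem lie_mem_weightVectors {l m : Module.Dual ℂ (complexify c)} {y : ℂ ⊗[ℝ] g}
    (hy : y ∈ rootSpace c m) {x : ℂ ⊗[ℝ] V} (hx : x ∈ weightVectors V c l) :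
    rhoC V y x ∈ weightVectors V c (m + l) := by
  rw [mem_weightVectors] at hx ⊢
  intro H
  rw [rhoC_rhoC, hy H, hx, map_smul, rhoC_smul, LinearMap.smul_apply, LinearMap.add_apply, add_smul]

/-- Weight spaces sit inside the joint generalized eigenspaces of the commuting operators from
`c^ℂ`, and distinct functionals are distinct families of eigenvalues. -/
theorem IsCartan.iSupIndep_weightVectors (hc : IsCartan c) :
    iSupIndep (weightVectors V c) := by
  let f : complexify c → Module.End ℂ (ℂ ⊗[ℝ] V) := fun H => rhoC V (H : ℂ ⊗[ℝ] g)
  have h := Module.End.independent_iInf_maxGenEigenspace_of_forall_mapsTo f (fun H K φ =>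
    Module.End.mapsTo_maxGenEigenspace_of_comm (by
      refine LinearMap.ext fun x => ?_
      have h2 := rhoC_rhoC (K : ℂ ⊗[ℝ] g) (H : ℂ ⊗[ℝ] g) x
      rwa [hc.lie_complexify K.2 H.2, rhoC_zero, LinearMap.zero_apply, zero_add] at h2) φ)
  have h2 := h.comp (f := fun l : Module.Dual ℂ (complexify c) => (l : complexify c → ℂ))
    DFunLike.coe_injective
  exact h2.mono fun l => iInf_mono fun H => (f H).genEigenspace_le_maximal _ 1

theorem IsIrreducible.le_of_mem {M : LieSubmodule ℂ (ℂ ⊗[ℝ] g) (ℂ ⊗[ℝ] V)}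
    (hM : LieModule.IsIrreducible ℂ (ℂ ⊗[ℝ] g) M) {N : LieSubmodule ℂ (ℂ ⊗[ℝ] g) (ℂ ⊗[ℝ] V)}
    {v : ℂ ⊗[ℝ] V} (hv : v ≠ 0) (hvM : v ∈ M) (hvN : v ∈ N) : M ≤ N := by
  have h := (IsSimpleOrder.eq_bot_or_eq_top (N.comap M.incl)).resolve_left fun h => by
    have : (⟨v, hvM⟩ : M) ∈ N.comap M.incl := hvN
    rw [h, LieSubmodule.mem_bot] at this
    exact hv (congrArg Subtype.val this)
  intro x hx
  have : (⟨x, hx⟩ : M) ∈ N.comap M.incl := h ▸ LieSubmodule.mem_top _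
  exact this

variable {P C : Set (Module.Dual ℂ (complexify c))}

/-- A subspace that contains a high weight vector of an irreducible module and is stable under the
root vectors of negative roots contains the module. -/
theorem IsHighWeightVector.le_of_stable [Module.Finite ℝ g] (hc : IsCartan c)
    (hC : IsPositiveCone c C) (hP : P = roots c ∩ C)
    {M : LieSubmodule ℂ (ℂ ⊗[ℝ] g) (ℂ ⊗[ℝ] V)} (hM : LieModule.IsIrreducible ℂ (ℂ ⊗[ℝ] g) M)
    {v : ℂ ⊗[ℝ] V} (hvM : v ∈ M) (hv : IsHighWeightVector c P v) {N : Submodule ℂ (ℂ ⊗[ℝ] V)}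
    (hvN : v ∈ N)
    (hN : ∀ l, -l ∈ C → ∀ y ∈ rootSpace c l, ∀ m ∈ N, rhoC V y m ∈ N) :
    M.toSubmodule ≤ N := by
  let good : Submodule ℂ (ℂ ⊗[ℝ] V) → Prop := fun N => v ∈ N ∧
    ∀ l, -l ∈ C → ∀ y ∈ rootSpace c l, ∀ m ∈ N, rhoC V y m ∈ N
  -- The minimality of `K` gives the induction principle for iterated negative root vectors applied
  -- to `v`.
  let K : Submodule ℂ (ℂ ⊗[ℝ] V) := sInf {N | good N}
  have hKle : ∀ N, good N → K ≤ N := fun N hN => sInf_le hN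
  have hvK : v ∈ K := Submodule.mem_sInf.mpr fun N hN => hN.1
  have hK : ∀ l, -l ∈ C → ∀ y ∈ rootSpace c l, ∀ m ∈ K, rhoC V y m ∈ K := fun l hl y hy m hm =>
    Submodule.mem_sInf.mpr fun N hN => hN.2 l hl y hy m (hKle N hN hm)
  -- `K'` collects the vectors of `K` that all of `g^ℂ` maps into `K`. If it contains `v` and has
  -- the same stability, then minimality gives `K = K'`, so `K` is invariant.
  let K' : Submodule ℂ (ℂ ⊗[ℝ] V) :=
    { carrier := {w | w ∈ K ∧ ∀ z : ℂ ⊗[ℝ] g, rhoC V z w ∈ K}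
      add_mem' := fun {a b} ha hb =>
        ⟨add_mem ha.1 hb.1, fun z => by rw [map_add]; exact add_mem (ha.2 z) (hb.2 z)⟩
      zero_mem' := ⟨zero_mem _, fun z => by rw [map_zero]; exact zero_mem _⟩
      smul_mem' := fun a x hx =>
        ⟨K.smul_mem a hx.1, fun z => by rw [map_smul]; exact K.smul_mem a (hx.2 z)⟩ }
  have hvK' : ∀ z : ℂ ⊗[ℝ] g, rhoC V z v ∈ K := by
    let S : Submodule ℂ (ℂ ⊗[ℝ] g) :=
      { carrier := {z | rhoC V z v ∈ K}
        add_mem' := fun {a b} ha hb => by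
          change rhoC V (a + b) v ∈ K
          rw [rhoC_add]; exact add_mem ha hb
        zero_mem' := by
          change rhoC V (0 : ℂ ⊗[ℝ] g) v ∈ K
          rw [rhoC_zero]; exact zero_mem _
        smul_mem' := fun a x hx => by
          change rhoC V (a • x) v ∈ K
          rw [rhoC_smul]; exact K.smul_mem a hx }
    have hS : S = ⊤ := by
      rw [← top_le_iff, ← hc.iSup_rootSpace, iSup_le_iff]
      intro l z hz
      change rhoC V z v ∈ K
      rcases eq_or_ne l 0 with rfl | hl
      · obtain ⟨m, hm⟩ := hv.exists_weight
        have : rhoC V z v = _ := hm ⟨z, hc.rootSpace_zero_le hz⟩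
        rw [this]
        exact K.smul_mem _ hvK
      rcases hC.mem_or_neg_mem l hl with h | h
      · rcases eq_or_ne z 0 with rfl | hz0
        · rw [rhoC_zero]; exact zero_mem _
        have hlP : l ∈ P := by
          rw [hP]
          exact ⟨⟨hl, fun hbot => hz0 (by rw [hbot] at hz; simpa using hz)⟩, h⟩
        have : rhoC V z v = 0 := hv.nilradical_lie z (Submodule.mem_iSup_of_mem l
          (Submodule.mem_iSup_of_mem hlP hz))
        rw [this]; exact zero_mem _
      · exact hK l h z hz v hvK
    exact fun z => (hS ▸ Submodule.mem_top : z ∈ S)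
  -- Stability of `K'` follows from `z y m = [z, y] m + y z m`, where `[z, y] m` and `z m` lie in
  -- `K` because `m` is in `K'`.
  have hKK' : K ≤ K' := hKle K' ⟨⟨hvK, hvK'⟩, fun l hl y hy m hm => ⟨hK l hl y hy m hm.1, fun z => by
    rw [rhoC_rhoC]
    exact add_mem (hm.2 _) (hK l hl y hy _ (hm.2 z))⟩⟩
  let L : LieSubmodule ℂ (ℂ ⊗[ℝ] g) (ℂ ⊗[ℝ] V) :=
    { K with lie_mem := fun {z w} hw => (hKK' hw).2 z }
  have hML : M ≤ L := IsIrreducible.le_of_mem hM hv.ne_zero hvM hvK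
  exact fun x hx => hKle N ⟨hvN, hN⟩ (hML hx)

/-- The line of `v` plus the sum `Q` of the weight spaces strictly below `l` is stable under
negative root vectors, hence contains `M`. Independence of weight spaces then locates the weight
vector `w`. -/
theorem IsHighWeightVector.eq_smul_or_sub_mem [Module.Finite ℝ g] (hc : IsCartan c)
    (hC : IsPositiveCone c C) (hP : P = roots c ∩ C)
    {M : LieSubmodule ℂ (ℂ ⊗[ℝ] g) (ℂ ⊗[ℝ] V)} (hM : LieModule.IsIrreducible ℂ (ℂ ⊗[ℝ] g) M)
    {v w : ℂ ⊗[ℝ] V} (hvM : v ∈ M) (hv : IsHighWeightVector c P v) (hwM : w ∈ M) (hw : w ≠ 0)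
    {l m : Module.Dual ℂ (complexify c)} (hl : v ∈ weightVectors V c l)
    (hm : w ∈ weightVectors V c m) : (∃ k : ℂ, w = k • v) ∨ l - m ∈ C := by
  have hCne : ∀ n, l - n ∈ C → n ≠ l := by
    rintro n hn rfl
    rw [sub_self] at hn
    exact hC.zero_notMem hn
  have hind : ∀ n, Disjoint (weightVectors V c n) (⨆ k, ⨆ _ : k ≠ n, weightVectors V c k) :=
    hc.iSupIndep_weightVectors
  let Q : Submodule ℂ (ℂ ⊗[ℝ] V) := ⨆ n, ⨆ _ : l - n ∈ C, weightVectors V c n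
  have hQmem : ∀ n, l - n ∈ C → weightVectors V c n ≤ Q := fun n hn =>
    le_iSup₂_of_le n hn le_rfl
  have hQle : ∀ N : Submodule ℂ (ℂ ⊗[ℝ] V), (∀ n, l - n ∈ C → weightVectors V c n ≤ N) → Q ≤ N :=
    fun N h => iSup₂_le h
  clear_value Q
  have hQ : ∀ k, -k ∈ C → ∀ y ∈ rootSpace c k, ∀ x ∈ Q, rhoC V y x ∈ Q := by
    intro k hk y hy
    have : Q ≤ Q.comap (rhoC V y) := hQle _ fun n hn x hx =>
      hQmem (k + n)
        (by rw [show l - (k + n) = -k + (l - n) by abel]; exact hC.add_mem _ hk _ hn)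
        (lie_mem_weightVectors hy hx)
    exact this
  have hwQ : w ∈ Submodule.span ℂ {v} ⊔ Q := by
    refine hv.le_of_stable hc hC hP hM hvM
      (Submodule.mem_sup_left (Submodule.mem_span_singleton_self v)) (fun k hk y hy x hx => ?_) hwM
    refine Submodule.mem_sup_right ?_
    obtain ⟨_, hxv, q, hq, rfl⟩ := Submodule.mem_sup.mp hx
    obtain ⟨a, rfl⟩ := Submodule.mem_span_singleton.mp hxv
    rw [map_add, map_smul]
    exact add_mem (Q.smul_mem _ (hQmem (k + l)
      (by rwa [show l - (k + l) = -k by abel]) (lie_mem_weightVectors hy hl))) (hQ k hk y hy q hq)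
  by_contra! hcon
  obtain ⟨hsm, hlm⟩ := hcon
  rcases eq_or_ne m l with rfl | hne
  · obtain ⟨x, hx, q, hq, rfl⟩ := Submodule.mem_sup.mp hwQ
    obtain ⟨a, rfl⟩ := Submodule.mem_span_singleton.mp hx
    have hqm : q ∈ weightVectors V c m := by
      simpa using sub_mem hm (Submodule.smul_mem _ a hl)
    have hq0 : q = 0 := Submodule.disjoint_def.mp (hind m) q hqm
      (hQle _ (fun n hn => le_iSup₂_of_le n (hCne n hn) le_rfl) hq)
    exact hsm a (by rw [hq0, add_zero])
  · refine hw (Submodule.disjoint_def.mp (hind m) w hm ?_)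
    refine (sup_le ?_ ?_ : Submodule.span ℂ {v} ⊔ Q ≤ _) hwQ
    · rw [Submodule.span_singleton_le_iff_mem]
      exact Submodule.mem_iSup_of_mem l (Submodule.mem_iSup_of_mem hne.symm hl)
    · exact hQle _ fun n hn => le_iSup₂_of_le n (by rintro rfl; exact hlm hn) le_rfl

/-- The high weight vectors of an irreducible module are proportional. -/
theorem IsHighWeightVector.exists_eq_smul [Module.Finite ℝ g] (hc : IsCartan c)
    (hP : IsPositiveSystem c P)
    {M : LieSubmodule ℂ (ℂ ⊗[ℝ] g) (ℂ ⊗[ℝ] V)} (hM : LieModule.IsIrreducible ℂ (ℂ ⊗[ℝ] g) M)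
    {v w : ℂ ⊗[ℝ] V} (hvM : v ∈ M) (hv : IsHighWeightVector c P v) (hwM : w ∈ M)
    (hw : IsHighWeightVector c P w) : ∃ k : ℂ, w = k • v := by
  obtain ⟨C, hC, hPC⟩ := hP
  obtain ⟨l, hl⟩ := hv.exists_weight
  obtain ⟨m, hm⟩ := hw.exists_weight
  have hl' : v ∈ weightVectors V c l := mem_weightVectors.mpr hl
  have hm' : w ∈ weightVectors V c m := mem_weightVectors.mpr hm
  rcases hv.eq_smul_or_sub_mem hc hC hPC hM hvM hwM hw.ne_zero hl' hm' with h | h1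
  · exact h
  rcases hw.eq_smul_or_sub_mem hc hC hPC hM hwM hvM hv.ne_zero hm' hl' with ⟨k, hk⟩ | h2
  · have hk0 : k ≠ 0 := by
      rintro rfl
      exact hv.ne_zero (by simpa using hk)
    exact ⟨k⁻¹, by rw [hk, inv_smul_smul₀ hk0]⟩
  · exact absurd (by simpa using hC.add_mem _ h1 _ h2) hC.zero_notMem

end Representations

/-! ### Vanishing of a wedge of two vectors -/

section Exterior

/-- If `v ∧ u = 0` and `v ≠ 0`, then `u` is a multiple of `v`. -/
theorem exists_eq_smul_of_ι_mul_ι_eq_zero {W : Type*} [AddCommGroup W] [Module ℂ W] {v u : W}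
    (hv : v ≠ 0) (h : ExteriorAlgebra.ι ℂ v * ExteriorAlgebra.ι ℂ u = 0) : ∃ k : ℂ, u = k • v := by
  by_contra! hu
  have hnot : u ∉ Submodule.span ℂ {v} := fun hmem => by
    obtain ⟨k, hk⟩ := Submodule.mem_span_singleton.mp hmem
    exact hu k hk.symm
  obtain ⟨f, hf⟩ : ∃ f : Module.Dual ℂ W, f v ≠ 0 := by
    by_contra! hcon
    exact hv ((Module.forall_dual_apply_eq_zero_iff ℂ v).mp hcon)
  obtain ⟨e, he, hN⟩ := Submodule.exists_dual_map_eq_bot_of_notMem hnot inferInstance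
  have hev : e v = 0 := by
    have : e v ∈ (Submodule.span ℂ {v}).map e := ⟨v, Submodule.mem_span_singleton_self v, rfl⟩
    rwa [hN] at this
  -- The form `f ∧ e` takes the value `f v * e u` on `(v, u)`, since `e v = 0`; this is nonzero, so
  -- `v ∧ u` cannot vanish.
  let D : W [⋀^Fin 2]→ₗ[ℂ] ℂ :=
    (Matrix.detRowAlternating (n := Fin 2) (R := ℂ)).compLinearMap (LinearMap.pi ![f, e])
  have hL := ExteriorAlgebra.liftAlternating_apply_ιMulti (R := ℂ)
    (Pi.single (M := fun i => W [⋀^Fin i]→ₗ[ℂ] ℂ) 2 D) ![v, u]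
  have h0 : ExteriorAlgebra.ιMulti ℂ 2 ![v, u] = 0 := by
    rw [← h]
    simp [ExteriorAlgebra.ιMulti_apply]
  rw [h0, map_zero, Pi.single_eq_same] at hL
  have hD : D ![v, u] = f v * e u - f u * e v := by
    refine (Matrix.det_fin_two (Matrix.of fun i => LinearMap.pi ![f, e] (![v, u] i))).trans ?_
    simp [mul_comm]
  rw [hD, hev, mul_zero, sub_zero] at hL
  exact mul_ne_zero hf he hL.symm

theorem ι_mul_ι_smul {W : Type*} [AddCommGroup W] [Module ℂ W] (v : W) (k : ℂ) :
    ExteriorAlgebra.ι ℂ v * ExteriorAlgebra.ι ℂ (k • v) = 0 := by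
  rw [map_smul, mul_smul_comm, ExteriorAlgebra.ι_sq_zero, smul_zero]

end Exterior

/-! ### Standard triples and conjugate root spaces -/

section Roots

variable {g : Type*} [LieRing g] [LieAlgebra ℝ g]
variable {c : LieSubalgebra ℝ g} {P : Set (Module.Dual ℂ (complexify c))}

/-- The degenerate triple with `X α = 0` satisfies the bracket relations too, and then `H α = 0`. In
both cases the simple reflection is an involution. -/
theorem StandardTriples.apply_H (T : StandardTriples c P) {α : Module.Dual ℂ (complexify c)}
    (hα : α ∈ simpleRoots c P) : α (T.H α) = 2 ∨ T.H α = 0 := by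
  rcases eq_or_ne (T.X α) 0 with h | h
  · right
    have := T.lie_X_Y α hα
    rw [h, adC_zero, LinearMap.zero_apply] at this
    exact Subtype.ext this.symm
  · left
    have h1 := T.lie_H_X α hα
    rw [T.X_mem α hα] at h1
    exact smul_left_injective ℂ h h1

theorem conj_mem_rootSpace {l : Module.Dual ℂ (complexify c)} {x : ℂ ⊗[ℝ] g}
    (hx : x ∈ rootSpace c (conjDual c l)) : conj x ∈ rootSpace c l := by
  intro H
  have h := hx ⟨conj (H : ℂ ⊗[ℝ] g), conj_mem_complexify c H.2⟩
  have h2 := conj_rhoC (V := g) (conj (H : ℂ ⊗[ℝ] g)) x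
  rw [conj_conj] at h2
  change _ = adC (H : ℂ ⊗[ℝ] g) (conj x) at h2
  rw [← h2]
  refine (congrArg conj h).trans ?_
  rw [LinearMap.map_smulₛₗ]
  congr 1
  simp [conjDual]

end Roots

/-! ### Lifting simple reflections to the Lie algebra and to the representation -/

section SimpleReflections

variable {g : Type*} [LieRing g] [LieAlgebra ℝ g] [Module.Finite ℝ g]
variable {V : Type*} [AddCommGroup V] [Module ℝ V] [Module.Finite ℝ V]
  [LieRingModule g V] [LieModule ℝ g V]

/-- The map `ρ^ℂ` intertwines `ad x` with the commutator by `ρ^ℂ(x)`, hence also their exponentials.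
-/
theorem expEnd_rhoC_mul (x z : ℂ ⊗[ℝ] g) :
    expEnd (rhoC V x) * rhoC V z = rhoC V (expEnd (adC x) z) * expEnd (rhoC V x) := by
  let F : (ℂ ⊗[ℝ] g) →ₗ[ℂ] Module.End ℂ (ℂ ⊗[ℝ] V) :=
    { toFun := fun y => rhoC V y, map_add' := rhoC_add, map_smul' := rhoC_smul }
  have h := expEnd_intertwine F (A := adC x)
    (B := LinearMap.mulLeft ℂ (rhoC V x) + LinearMap.mulRight ℂ (-rhoC V x)) (fun w => by
      refine LinearMap.ext fun m => ?_
      have := rhoC_rhoC x w m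
      change rhoC V (adC x w) m = rhoC V x (rhoC V w m) + rhoC V w (-rhoC V x m)
      rw [this, map_neg, add_neg_cancel_right]) z
  rw [expEnd_mul]
  exact congrArg (· * expEnd (rhoC V x)) h.symm

theorem expEnd_adC_mul (x z : ℂ ⊗[ℝ] g) :
    expEnd (adC x) * adC z = adC (expEnd (adC x) z) * expEnd (adC x) :=
  expEnd_rhoC_mul (V := g) x z

variable {c : LieSubalgebra ℝ g} {P : Set (Module.Dual ℂ (complexify c))}

/-- `exp(ad X_α) exp(-ad Y_α) exp(ad X_α)`, the lift of a simple reflection to `g^ℂ`. -/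
def simpleAd (T : StandardTriples c P) (α : Module.Dual ℂ (complexify c)) :
    Module.End ℂ (ℂ ⊗[ℝ] g) :=
  expEnd (adC (T.X α)) * expEnd (adC (-T.Y α)) * expEnd (adC (T.X α))

theorem simpleRep_mul_rhoC (T : StandardTriples c P) (α : Module.Dual ℂ (complexify c))
    (z : ℂ ⊗[ℝ] g) :
    (simpleRep V T α : Module.End ℂ (ℂ ⊗[ℝ] V)) * rhoC V z
      = rhoC V (simpleAd T α z) * (simpleRep V T α : Module.End ℂ (ℂ ⊗[ℝ] V)) := by
  have h : (simpleRep V T α : Module.End ℂ (ℂ ⊗[ℝ] V))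
      = expEnd (rhoC V (T.X α)) * expEnd (rhoC V (-T.Y α)) * expEnd (rhoC V (T.X α)) := by
    rw [rhoC_neg]; rfl
  rw [h, mul_assoc, expEnd_rhoC_mul, ← mul_assoc, mul_assoc (expEnd (rhoC V (T.X α))),
    expEnd_rhoC_mul, ← mul_assoc, expEnd_rhoC_mul]
  simp only [mul_assoc, simpleAd, Module.End.mul_apply]

theorem simpleAd_adC (T : StandardTriples c P) (α : Module.Dual ℂ (complexify c))
    (z x : ℂ ⊗[ℝ] g) :
    simpleAd T α (adC z x) = adC (simpleAd T α z) (simpleAd T α x) := by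
  have h : simpleAd T α * adC z = adC (simpleAd T α z) * simpleAd T α := by
    unfold simpleAd
    rw [mul_assoc, expEnd_adC_mul, ← mul_assoc, mul_assoc (expEnd (adC (T.X α))),
      expEnd_adC_mul, ← mul_assoc, expEnd_adC_mul]
    simp only [mul_assoc, Module.End.mul_apply]
  exact LinearMap.congr_fun h x

/-- A computation in the span of `H`, `X α`, `Y α` and `H α`. On the vectors that occur, each
exponential series stops by degree two. -/
theorem simpleAd_coe (T : StandardTriples c P)
    {α : Module.Dual ℂ (complexify c)} (hα : α ∈ simpleRoots c P) (H : complexify c) :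
    simpleAd T α H = ((H - α H • T.H α : complexify c) : ℂ ⊗[ℝ] g) := by
  set X := T.X α with hX
  set Y := T.Y α with hY
  set K : ℂ ⊗[ℝ] g := (T.H α : ℂ ⊗[ℝ] g) with hK
  have hHX : adC X (H : ℂ ⊗[ℝ] g) = -α H • X := by
    rw [adC_swap, T.X_mem α hα H, neg_smul]
  have hHY : adC (-Y) (H : ℂ ⊗[ℝ] g) = -α H • Y := by
    rw [adC_neg, LinearMap.neg_apply, adC_swap, T.Y_mem α hα H, neg_neg, LinearMap.neg_apply]
  have hXX : adC X X = 0 := lie_self X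
  have hYY : adC (-Y) Y = 0 := by
    rw [adC_neg, LinearMap.neg_apply, show adC Y Y = 0 from lie_self Y, neg_zero]
  have hXY : adC X Y = K := T.lie_X_Y α hα
  have hYX : adC (-Y) X = K := by
    rw [adC_neg, LinearMap.neg_apply, adC_swap, hXY, neg_neg]
  have hXK : adC X K = (-2 : ℂ) • X := by
    rw [adC_swap, T.lie_H_X α hα, neg_smul]
  have hYK : adC (-Y) K = (-2 : ℂ) • Y := by
    rw [adC_neg, LinearMap.neg_apply, adC_swap, T.lie_H_Y α hα, neg_neg]
  have eX_H : expEnd (adC X) (H : ℂ ⊗[ℝ] g) = (H : ℂ ⊗[ℝ] g) - α H • X := by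
    rw [expEnd_apply_of_cube] <;> simp only [hHX, map_smul, hXX, smul_zero, map_zero]
    rw [add_zero, neg_smul, sub_eq_add_neg]
  have eX_X : expEnd (adC X) X = X := by
    rw [expEnd_apply_of_cube] <;> simp only [hXX, smul_zero, map_zero, add_zero]
  have eX_K : expEnd (adC X) K = K - (2 : ℂ) • X := by
    rw [expEnd_apply_of_cube] <;> simp only [hXK, map_smul, hXX, smul_zero, map_zero]
    rw [add_zero, neg_smul, sub_eq_add_neg]
  have eY_H : expEnd (adC (-Y)) (H : ℂ ⊗[ℝ] g) = (H : ℂ ⊗[ℝ] g) - α H • Y := by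
    rw [expEnd_apply_of_cube] <;> simp only [hHY, map_smul, hYY, smul_zero, map_zero]
    rw [add_zero, neg_smul, sub_eq_add_neg]
  have eY_X : expEnd (adC (-Y)) X = X + K - Y := by
    rw [expEnd_apply_of_cube] <;> simp only [hYX, hYK, map_smul, hYY, smul_zero]
    rw [smul_smul, sub_eq_add_neg]
    norm_num
  unfold simpleAd
  rw [← hX, ← hY, Module.End.mul_apply, Module.End.mul_apply, eX_H, map_sub, map_smul, eY_H, eY_X,
    show (H : ℂ ⊗[ℝ] g) - α H • Y - α H • (X + K - Y)
      = (H : ℂ ⊗[ℝ] g) - α H • X - α H • K by module,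
    map_sub, map_sub, map_smul, map_smul, eX_H, eX_X, eX_K, Submodule.coe_sub,
    Submodule.coe_smul, ← hK]
  module

/-- For `K = H - α(H) H_α` the automorphism sends `K` back to `H`, so `[H, Φ x] = Φ [K, x] = l(K) Φ
x` with `Φ = simpleAd T α`, and `l(K)` is the value at `H` of the reflected functional. -/
theorem simpleAd_mem_rootSpace (T : StandardTriples c P)
    {α : Module.Dual ℂ (complexify c)} (hα : α ∈ simpleRoots c P)
    {l : Module.Dual ℂ (complexify c)} {x : ℂ ⊗[ℝ] g} (hx : x ∈ rootSpace c l) :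
    simpleAd T α x ∈ rootSpace c (reflection T α l) := by
  intro H
  set K : complexify c := H - α H • T.H α with hK
  have hKH : K - α K • T.H α = H := by
    rcases T.apply_H hα with h | h
    · rw [hK, map_sub, map_smul, h, smul_eq_mul]
      module
    · simp [hK, h]
  have h1 := simpleAd_adC T α (K : ℂ ⊗[ℝ] g) x
  rw [simpleAd_coe T hα, hKH, hx K, map_smul] at h1
  rw [← h1]
  congr 1
  simp [hK, reflection, Module.preReflection_apply, mul_comm]

/-- The automorphism of `g^ℂ` that lifts a product of simple reflections. -/
theorem exists_omegaAd (T : StandardTriples c P)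
    {β : List (Module.Dual ℂ (complexify c))} (hβ : ∀ α ∈ β, α ∈ simpleRoots c P) :
    ∃ Φ : Module.End ℂ (ℂ ⊗[ℝ] g),
      (∀ z, (omegaRep V T β : Module.End ℂ (ℂ ⊗[ℝ] V)) * rhoC V z
        = rhoC V (Φ z) * (omegaRep V T β : Module.End ℂ (ℂ ⊗[ℝ] V))) ∧
      (∀ H ∈ complexify c, Φ H ∈ complexify c) ∧
      ∀ l, ∀ x ∈ rootSpace c l, Φ x ∈ rootSpace c ((β.map (reflection T)).prod l) := by
  induction β with
  | nil => exact ⟨1, fun z => by simp [omegaRep], fun H hH => hH, fun l x hx => hx⟩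
  | cons α β ih =>
    obtain ⟨Φ, h1, h2, h3⟩ := ih fun γ hγ => hβ γ (List.mem_cons_of_mem _ hγ)
    have hα := hβ α List.mem_cons_self
    refine ⟨simpleAd T α * Φ, fun z => ?_, fun H hH => ?_, fun l x hx => ?_⟩
    · have h : (omegaRep V T (α :: β) : Module.End ℂ (ℂ ⊗[ℝ] V))
          = (simpleRep V T α : Module.End ℂ (ℂ ⊗[ℝ] V)) *
            (omegaRep V T β : Module.End ℂ (ℂ ⊗[ℝ] V)) := by
        simp [omegaRep]
      rw [h, mul_assoc, h1, ← mul_assoc, simpleRep_mul_rhoC, mul_assoc, Module.End.mul_apply]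
    · have := simpleAd_coe T hα ⟨Φ H, h2 H hH⟩
      rw [Module.End.mul_apply, this]
      exact Subtype.property _
    · rw [List.map_cons, List.prod_cons, Module.End.mul_apply, Module.End.mul_apply]
      exact simpleAd_mem_rootSpace T hα (h3 l x hx)

/-- `ω_ρ⁻¹ v̄` is a high weight vector. -/
theorem IsHighWeightVector.omega_inv_conj (T : StandardTriples c P)
    {β : List (Module.Dual ℂ (complexify c))} (hβ : IsConjugatingWord T β)
    {v : ℂ ⊗[ℝ] V} (hv : IsHighWeightVector c P v) {u : ℂ ⊗[ℝ] V}
    (hu : (omegaRep V T β : Module.End ℂ (ℂ ⊗[ℝ] V)) u = conj v) :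
    IsHighWeightVector c P u := by
  obtain ⟨Φ, hΦ, hΦc, hΦroot⟩ := exists_omegaAd (V := V) T hβ.simple
  have hu0 : u ≠ 0 := by
    rintro rfl
    rw [map_zero] at hu
    exact hv.ne_zero (by rw [← conj_conj v, ← hu, map_zero])
  have hinj : ∀ x y : ℂ ⊗[ℝ] V, (omegaRep V T β : Module.End ℂ (ℂ ⊗[ℝ] V)) x
      = (omegaRep V T β : Module.End ℂ (ℂ ⊗[ℝ] V)) y → x = y := fun x y h => by
    have := congrArg ((↑(omegaRep V T β)⁻¹ : Module.End ℂ (ℂ ⊗[ℝ] V))) h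
    rwa [← Module.End.mul_apply, ← Module.End.mul_apply, Units.inv_mul] at this
  have hact : ∀ z, (omegaRep V T β : Module.End ℂ (ℂ ⊗[ℝ] V)) (rhoC V z u)
      = rhoC V (Φ z) (conj v) := fun z => by
    rw [← hu]
    exact LinearMap.congr_fun (hΦ z) u
  refine ⟨hu0, fun x hx => ?_, ?_⟩
  · let S : Submodule ℂ (ℂ ⊗[ℝ] g) :=
      { carrier := {z | rhoC V z u = 0}
        add_mem' := fun {a b} ha hb => by
          change rhoC V (a + b) u = 0
          rw [rhoC_add, LinearMap.add_apply, ha, hb, add_zero]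
        zero_mem' := by
          change rhoC V (0 : ℂ ⊗[ℝ] g) u = 0
          rw [rhoC_zero, LinearMap.zero_apply]
        smul_mem' := fun a z hz => by
          change rhoC V (a • z) u = 0
          rw [rhoC_smul, LinearMap.smul_apply, hz, smul_zero] }
    have hS : nilradical c P ≤ S := iSup₂_le fun α hα z hz => by
      change rhoC V z u = 0
      apply hinj
      rw [hact, map_zero]
      -- As `Φ z` has root `δ^σ` with `δ` positive, its conjugate has root `δ` and kills `v`.
      -- Conjugating, `Φ z` kills `v̄`.
      obtain ⟨δ, hδ, hδα⟩ : (β.map (reflection T)).prod α ∈ conjDual c '' P :=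
        hβ.image_eq ▸ ⟨α, hα, rfl⟩
      have hmem := hΦroot α z hz
      rw [← hδα] at hmem
      have h0 := hv.nilradical_lie _
        (Submodule.mem_iSup_of_mem δ (Submodule.mem_iSup_of_mem hδ (conj_mem_rootSpace hmem)))
      have h1 := conj_rhoC (conj (Φ z)) v
      rw [h0, map_zero, conj_conj] at h1
      exact h1.symm
    exact hS hx
  · obtain ⟨l, hl⟩ := hv.exists_weight
    let F : complexify c →ₗ[ℂ] Module.End ℂ (ℂ ⊗[ℝ] V) :=
      { toFun := fun H => rhoC V (H : ℂ ⊗[ℝ] g)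
        map_add' := fun a b => rhoC_add _ _
        map_smul' := fun a b => rhoC_smul _ _ }
    refine exists_dual_of_forall_exists_smul F hu0 fun H => ?_
    -- The weight of `u` at `H` is forced: `ω_ρ` turns `H` into `Φ H`, whose eigenvalue on `v̄` is
    -- the conjugate of the value of `l` at `σ(Φ H)`.
    refine ⟨starRingEnd ℂ (l ⟨conj (Φ H), conj_mem_complexify c (hΦc H H.2)⟩), hinj _ _ ?_⟩
    have h1 := conj_rhoC (conj (Φ H)) v
    rw [conj_conj] at h1
    refine (hact H).trans (h1.symm.trans ?_)
    refine (congrArg conj (hl ⟨conj (Φ H), conj_mem_complexify c (hΦc H H.2)⟩)).trans ?_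
    rw [LinearMap.map_smulₛₗ, map_smul, hu]

end SimpleReflections

/-! ### Subgroups of GL preserving a subspace, and orbit spans -/

section Stabilizer

variable {W : Type*} [AddCommGroup W] [Module ℂ W]

/-- The elements of `GL(W)` that preserve a subspace, together with their inverses. -/
def stabilizer (N : Submodule ℂ W) : Subgroup (LinearMap.GeneralLinearGroup ℂ W) where
  carrier := {a | (∀ w ∈ N, (a : Module.End ℂ W) w ∈ N) ∧
    ∀ w ∈ N, (↑a⁻¹ : Module.End ℂ W) w ∈ N}
  mul_mem' := fun {a b} ha hb =>
    ⟨fun w hw => ha.1 _ (hb.1 w hw), fun w hw => by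
      rw [mul_inv_rev]
      exact hb.2 _ (ha.2 w hw)⟩
  one_mem' := ⟨fun w hw => hw, fun w hw => by rw [inv_one]; exact hw⟩
  inv_mem' := fun {a} ha => ⟨ha.2, fun w hw => by rw [inv_inv]; exact ha.1 w hw⟩

theorem mem_orbitSpan (G : Subgroup (LinearMap.GeneralLinearGroup ℂ W)) (w : W) :
    w ∈ orbitSpan G w :=
  Submodule.subset_span ⟨1, G.one_mem, rfl⟩

theorem orbitSpan_le {G : Subgroup (LinearMap.GeneralLinearGroup ℂ W)} {N : Submodule ℂ W}
    (hG : G ≤ stabilizer N) {w : W} (hw : w ∈ N) : orbitSpan G w ≤ N := by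
  refine Submodule.span_le.mpr ?_
  rintro _ ⟨a, ha, rfl⟩
  exact (hG ha).1 w hw

theorem apply_mem_orbitSpan {G : Subgroup (LinearMap.GeneralLinearGroup ℂ W)}
    {a : LinearMap.GeneralLinearGroup ℂ W} (ha : a ∈ G) {w x : W} (hx : x ∈ orbitSpan G w) :
    (a : Module.End ℂ W) x ∈ orbitSpan G w := by
  have : orbitSpan G w ≤ (orbitSpan G w).comap (a : Module.End ℂ W) := by
    refine Submodule.span_le.mpr ?_
    rintro _ ⟨b, hb, rfl⟩
    exact Submodule.subset_span ⟨a * b, G.mul_mem ha hb, rfl⟩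
  exact this hx

variable [Module.Finite ℂ W]

theorem expGL_mem_stabilizer {N : Submodule ℂ W} {A : Module.End ℂ W} (h : ∀ w ∈ N, A w ∈ N) :
    expGL A ∈ stabilizer N :=
  ⟨fun _ hw => expEnd_mem h hw,
    fun _ hw => expEnd_mem (A := -A) (fun y hy => N.neg_mem (h y hy)) hw⟩

end Stabilizer

/-! ### Conjugate submodules, real points and orbits -/

section Representations

variable {g : Type*} [LieRing g] [LieAlgebra ℝ g]
variable {V : Type*} [AddCommGroup V] [Module ℝ V] [LieRingModule g V] [LieModule ℝ g V]

/-- The conjugate of an invariant subspace, as an invariant subspace. -/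
def conjLieSubmodule (M : LieSubmodule ℂ (ℂ ⊗[ℝ] g) (ℂ ⊗[ℝ] V)) :
    LieSubmodule ℂ (ℂ ⊗[ℝ] g) (ℂ ⊗[ℝ] V) :=
  { conjSubmodule M.toSubmodule with
    lie_mem := fun {x m} hm => by
      have hm' : conj m ∈ M.toSubmodule := mem_conjSubmodule.mp hm
      refine mem_conjSubmodule.mpr ?_
      have h : rhoC V (conj x) (conj m) ∈ M.toSubmodule := M.lie_mem hm'
      rw [← conj_rhoC] at h
      exact h }

/-- Irreducibility gives `M ≤ M̄`; applying the involution `σ` to this inclusion gives the reverse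
one. -/
theorem IsIrreducible.eq_conjSubmodule {M : LieSubmodule ℂ (ℂ ⊗[ℝ] g) (ℂ ⊗[ℝ] V)}
    (hM : LieModule.IsIrreducible ℂ (ℂ ⊗[ℝ] g) M)
    (h : M.toSubmodule ⊓ conjSubmodule M.toSubmodule ≠ ⊥) :
    M.toSubmodule = conjSubmodule M.toSubmodule := by
  obtain ⟨x, hx, hx0⟩ := Submodule.exists_mem_ne_zero_of_ne_bot h
  have hle : M ≤ conjLieSubmodule M := IsIrreducible.le_of_mem hM hx0 hx.1 hx.2
  refine le_antisymm (fun y hy => hle hy) fun y hy => ?_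
  have h2 : conj y ∈ conjSubmodule M.toSubmodule := hle (mem_conjSubmodule.mp hy)
  simpa using mem_conjSubmodule.mp h2

theorem mem_of_tmul_mem_baseChange {N : Submodule ℝ V} {y : V}
    (h : (1 : ℂ) ⊗ₜ[ℝ] y ∈ N.baseChange ℂ) : y ∈ N := by
  obtain ⟨n, hn⟩ := h
  obtain ⟨a, b, rfl⟩ := exists_real_parts n
  rw [map_add, map_smul, LinearMap.baseChange_tmul, LinearMap.baseChange_tmul] at hn
  have h0 : (1 : ℂ) ⊗ₜ[ℝ] ((a : V) - y) + Complex.I • ((1 : ℂ) ⊗ₜ[ℝ] (b : V)) = 0 := by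
    rw [TensorProduct.tmul_sub, ← hn]
    simp
  rw [← sub_eq_zero.mp (real_parts_eq_zero h0).1]
  exact a.2

/-- The real points of a conjugation invariant irreducible subspace form an irreducible subspace. -/
theorem IsIrreducible.realPoints {M : LieSubmodule ℂ (ℂ ⊗[ℝ] g) (ℂ ⊗[ℝ] V)}
    (hM : LieModule.IsIrreducible ℂ (ℂ ⊗[ℝ] g) M)
    (h : M.toSubmodule = conjSubmodule M.toSubmodule) :
    LieModule.IsIrreducible ℝ g (RealRep.realPoints M) := by
  have hconj : ∀ m ∈ M, conj m ∈ M := fun m hm => by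
    have : m ∈ conjSubmodule M.toSubmodule := h ▸ hm
    exact mem_conjSubmodule.mp this
  -- The real and imaginary parts of a vector of `M` are combinations of it and its conjugate, hence
  -- real points of `M`; they are not both zero if the vector is nonzero.
  have hnt : Nontrivial (RealRep.realPoints M) := by
    have := LieModule.nontrivial_of_isIrreducible ℂ (ℂ ⊗[ℝ] g) M
    obtain ⟨⟨m, hm⟩, hm0⟩ := exists_ne (0 : M)
    have hm0' : m ≠ 0 := fun h => hm0 (Subtype.ext h)
    obtain ⟨a, b, rfl⟩ := exists_real_parts m
    have hc := hconj _ hm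
    rw [map_add, LinearMap.map_smulₛₗ, conj_tmul, conj_tmul, map_one, Complex.conj_I] at hc
    have ha : (1 : ℂ) ⊗ₜ[ℝ] a ∈ M := by
      have := M.smul_mem ((2 : ℂ)⁻¹) (add_mem hm hc)
      rwa [show (2 : ℂ)⁻¹ • ((1 : ℂ) ⊗ₜ[ℝ] a + Complex.I • ((1 : ℂ) ⊗ₜ[ℝ] b)
        + ((1 : ℂ) ⊗ₜ[ℝ] a + -Complex.I • ((1 : ℂ) ⊗ₜ[ℝ] b))) = (1 : ℂ) ⊗ₜ[ℝ] a by module] at this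
    have hb : (1 : ℂ) ⊗ₜ[ℝ] b ∈ M := by
      have := M.smul_mem (-Complex.I) (sub_mem hm ha)
      rw [add_sub_cancel_left, smul_smul, neg_mul, Complex.I_mul_I, neg_neg, one_smul] at this
      exact this
    by_contra hcon
    rw [not_nontrivial_iff_subsingleton] at hcon
    have ha0 : a = 0 := congrArg Subtype.val
      (Subsingleton.elim (⟨a, ha⟩ : RealRep.realPoints M) 0)
    have hb0 : b = 0 := congrArg Subtype.val
      (Subsingleton.elim (⟨b, hb⟩ : RealRep.realPoints M) 0)
    exact hm0' (by rw [ha0, hb0]; simp)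
  refine LieModule.IsIrreducible.mk fun N hN => ?_
  let N' : LieSubmodule ℝ g V := N.map (RealRep.realPoints M).incl
  obtain ⟨x, hx, hx0⟩ := Submodule.exists_mem_ne_zero_of_ne_bot
    (p := N.toSubmodule) (by simpa using hN)
  -- The complexification of a nonzero invariant `N` meets `M` nontrivially, so it contains `M`;
  -- taking real points returns every real point of `M` to `N`.
  have hle : M ≤ N'.baseChange ℂ := by
    refine IsIrreducible.le_of_mem hM (v := (1 : ℂ) ⊗ₜ[ℝ] (x : V)) (fun h0 => hx0 ?_) x.2 ?_
    · refine Subtype.ext (real_parts_eq_zero (b := 0) ?_).1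
      rw [h0]
      simp
    · exact Submodule.tmul_mem_baseChange_of_mem (p := N'.toSubmodule) 1
        ((LieSubmodule.mem_map _).mpr ⟨x, hx, rfl⟩)
  rw [eq_top_iff]
  intro y _
  have hy : (y : V) ∈ N' :=
    mem_of_tmul_mem_baseChange (N := N'.toSubmodule) (hle y.2)
  obtain ⟨z, hz, hzy⟩ := (LieSubmodule.mem_map _).mp hy
  have : z = y := Subtype.ext hzy
  exact this ▸ hz

variable [Module.Finite ℝ V]

theorem complexGroup_le_stabilizer (M : LieSubmodule ℂ (ℂ ⊗[ℝ] g) (ℂ ⊗[ℝ] V)) :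
    complexGroup g V ≤ stabilizer M.toSubmodule := by
  refine (Subgroup.closure_le _).mpr ?_
  rintro _ ⟨z, X, rfl⟩
  exact expGL_mem_stabilizer fun w hw => M.smul_mem z (M.lie_mem hw)

theorem omegaRep_mem_stabilizer {c : LieSubalgebra ℝ g} {P : Set (Module.Dual ℂ (complexify c))}
    (T : StandardTriples c P) (β : List (Module.Dual ℂ (complexify c)))
    (M : LieSubmodule ℂ (ℂ ⊗[ℝ] g) (ℂ ⊗[ℝ] V)) :
    omegaRep V T β ∈ stabilizer M.toSubmodule := by
  refine Subgroup.list_prod_mem _ fun a ha => ?_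
  obtain ⟨α, -, rfl⟩ := List.mem_map.mp ha
  have hX : expGL (rhoC V (T.X α)) ∈ stabilizer M.toSubmodule :=
    expGL_mem_stabilizer fun w hw => M.lie_mem hw
  have hY : expGL (-rhoC V (T.Y α)) ∈ stabilizer M.toSubmodule :=
    expGL_mem_stabilizer fun w hw => M.toSubmodule.neg_mem (M.lie_mem hw)
  exact mul_mem (mul_mem hX hY) hX

/-- The span of an orbit of `G_ρ^ℂ` is invariant under `g^ℂ`. -/
theorem rhoC_mem_orbitSpan (z : ℂ ⊗[ℝ] g) {w x : ℂ ⊗[ℝ] V}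
    (hx : x ∈ orbitSpan (complexGroup g V) w) :
    rhoC V z x ∈ orbitSpan (complexGroup g V) w := by
  induction z using TensorProduct.induction_on with
  | zero => rw [rhoC_zero]; exact zero_mem _
  | add a b ha hb => rw [rhoC_add]; exact add_mem ha hb
  | tmul a X =>
    have h : rhoC V (a ⊗ₜ[ℝ] X) = a • rhoC V ((1 : ℂ) ⊗ₜ[ℝ] X) := by
      rw [← rhoC_smul, TensorProduct.smul_tmul', smul_eq_mul, mul_one]
    rw [h]
    refine Submodule.smul_mem _ a (apply_mem_of_expEnd_mem fun z => ?_)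
    exact apply_mem_orbitSpan (G := complexGroup g V)
      (a := expGL (z • rhoC V ((1 : ℂ) ⊗ₜ[ℝ] X))) (Subgroup.subset_closure ⟨z, X, rfl⟩) hx

/-- The orbit span is `g^ℂ`-invariant and contains `w ≠ 0`, so it contains `M`; it stays in `M`
because the group preserves `M`. -/
theorem IsIrreducible.eq_orbitSpan {M : LieSubmodule ℂ (ℂ ⊗[ℝ] g) (ℂ ⊗[ℝ] V)}
    (hM : LieModule.IsIrreducible ℂ (ℂ ⊗[ℝ] g) M) {w : ℂ ⊗[ℝ] V} (hw0 : w ≠ 0) (hw : w ∈ M) :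
    M.toSubmodule = orbitSpan (complexGroup g V) w := by
  let N : LieSubmodule ℂ (ℂ ⊗[ℝ] g) (ℂ ⊗[ℝ] V) :=
    { orbitSpan (complexGroup g V) w with
      lie_mem := fun {z x} hx => rhoC_mem_orbitSpan z hx }
  have hle : M ≤ N := IsIrreducible.le_of_mem hM hw0 hw (mem_orbitSpan _ w)
  exact le_antisymm (fun x hx => hle hx) (orbitSpan_le (complexGroup_le_stabilizer M) hw)

end Representations

end RealRep
end

/-! ### The criterion and its consequences -/

theorem lemma4p7
    {g : Type*} [LieRing g] [LieAlgebra ℝ g] [Module.Finite ℝ g] [LieAlgebra.IsSemisimple ℝ g]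
    {V : Type*} [AddCommGroup V] [Module ℝ V] [Module.Finite ℝ V]
    [LieRingModule g V] [LieModule ℝ g V]
    (c : LieSubalgebra ℝ g) (hc : RealRep.IsCartan c)
    (P : Set (Module.Dual ℂ (RealRep.complexify c))) (hP : RealRep.IsPositiveSystem c P)
    (T : RealRep.StandardTriples c P)
    (β : List (Module.Dual ℂ (RealRep.complexify c))) (hβ : RealRep.IsConjugatingWord T β)
    (M : LieSubmodule ℂ (ℂ ⊗[ℝ] g) (ℂ ⊗[ℝ] V))
    (hM : LieModule.IsIrreducible ℂ (ℂ ⊗[ℝ] g) M)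
    (v : ℂ ⊗[ℝ] V) (hvM : v ∈ M) (hv : RealRep.IsHighWeightVector c P v) :
    let ω : LinearMap.GeneralLinearGroup ℂ (ℂ ⊗[ℝ] V) := RealRep.omegaRep V T β
    let G : Subgroup (LinearMap.GeneralLinearGroup ℂ (ℂ ⊗[ℝ] V)) := RealRep.complexGroup g V
    let Mbar : Submodule ℂ (ℂ ⊗[ℝ] V) := RealRep.conjSubmodule M.toSubmodule
    let vbar : ℂ ⊗[ℝ] V := RealRep.conj v
    let u : ℂ ⊗[ℝ] V := ((ω⁻¹ : LinearMap.GeneralLinearGroup ℂ (ℂ ⊗[ℝ] V)) :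
      Module.End ℂ (ℂ ⊗[ℝ] V)) vbar
    (M.toSubmodule ⊓ Mbar ≠ ⊥ ↔ ExteriorAlgebra.ι ℂ v * ExteriorAlgebra.ι ℂ u = 0) ∧
    (M.toSubmodule ⊓ Mbar ≠ ⊥ →
      M.toSubmodule = Mbar ∧
      LieModule.IsIrreducible ℝ g (RealRep.realPoints M) ∧
      M.toSubmodule = RealRep.orbitSpan G v ∧
      M.toSubmodule = RealRep.orbitSpan G vbar ∧
      M.toSubmodule = RealRep.orbitSpan G u) := by
  intro ω G Mbar vbar u
  have hωu : (ω : Module.End ℂ (ℂ ⊗[ℝ] V)) u = vbar := by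
    change ((ω : Module.End ℂ (ℂ ⊗[ℝ] V)) * (↑ω⁻¹ : Module.End ℂ (ℂ ⊗[ℝ] V))) vbar = vbar
    rw [Units.mul_inv, Module.End.one_apply]
  have hu : RealRep.IsHighWeightVector c P u := hv.omega_inv_conj T hβ hωu
  have hvbar : vbar ∈ Mbar := RealRep.mem_conjSubmodule.mpr (by rwa [RealRep.conj_conj])
  -- The conjugate of `M` is `g^ℂ`-invariant, so `ω_ρ⁻¹` preserves it.
  have huM : u ∈ Mbar :=
    (RealRep.omegaRep_mem_stabilizer T β (RealRep.conjLieSubmodule M)).2 vbar hvbar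
  have heq : M.toSubmodule ⊓ Mbar ≠ ⊥ → M.toSubmodule = Mbar :=
    RealRep.IsIrreducible.eq_conjSubmodule hM
  refine ⟨⟨fun h => ?_, fun h => ?_⟩, fun h => ?_⟩
  · have huM' : u ∈ M.toSubmodule := heq h ▸ huM
    obtain ⟨k, hk⟩ := hv.exists_eq_smul hc hP hM hvM huM' hu
    rw [hk]
    exact RealRep.ι_mul_ι_smul v k
  · obtain ⟨k, hk⟩ := RealRep.exists_eq_smul_of_ι_mul_ι_eq_zero hv.ne_zero h
    have hmem : u ∈ M.toSubmodule ⊓ Mbar := ⟨hk ▸ M.smul_mem k hvM, huM⟩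
    exact fun hbot => hu.ne_zero (by rwa [hbot, Submodule.mem_bot] at hmem)
  · have hMM := heq h
    have hvbar0 : vbar ≠ 0 := fun h0 => hv.ne_zero (by
      rw [← RealRep.conj_conj v, show RealRep.conj v = 0 from h0, map_zero])
    exact ⟨hMM, RealRep.IsIrreducible.realPoints hM hMM,
      RealRep.IsIrreducible.eq_orbitSpan hM hv.ne_zero hvM,
      RealRep.IsIrreducible.eq_orbitSpan hM hvbar0 (by rw [← hMM] at hvbar; exact hvbar),
      RealRep.IsIrreducible.eq_orbitSpan hM hu.ne_zero (by rw [← hMM] at huM; exact huM)⟩
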